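/- Let $\mathcal{A}$ be a measurable space of actions, $\phi:\mathcal{A}\to\mathbb{R}^d$ a measurable feature map and $\theta^*\in\mathbb{R}^d$ with $\|\theta^*\|_2\le B$ for some $B>0$. In each round $t=1,2,\dots$ an action set $\mathcal{A}_t\subseteq\mathcal{A}$ (possibly random) is revealed, a (random) action $a_t\in\mathcal{A}_t$ is played, and the reward $r_t=\phi(a_t)^\top\theta^*+\epsilon_t$ is observed. Let $\mathcal{H}_t$ be the $\sigma$-algebra generated by $a_1,r_1,\dots,a_t,r_t,a_{t+1}$, and suppose that, for some $\sigma>0$ and all $t\ge1$, $\mathbb{E}[\epsilon_t\mid\mathcal{H}_{t-1}]=0$ and $\mathbb{E}[e^{\lambda\epsilon_t}\mid\mathcal{H}_{t-1}]\le e^{\lambda^2\sigma^2/2}$ for all $\lambda\in\mathbb{R}$. Assume that in each round there is an optimal action $a_t^*\in\arg\max_{a\in\mathcal{A}_t}\phi(a)^\top\theta^*$, and let $\Delta_{1:T}=\sum_{t=1}^T\left(\phi(a_t^*)^\top\theta^*-\phi(a_t)^\top\theta^*\right)$ be the cumulative regret. Let $P_t=\mathcal{N}(\mu_t,\mathbf{T}_t)$,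 $t\ge1$, be an adaptive sequence of Gaussian mixture distributions: $\mu_t\in\mathbb{R}^t$ and $\mathbf{T}_t\in\mathbb{R}^{t\times t}$ are $\mathcal{H}_{t-1}$-measurable, $\mathbf{T}_t$ is symmetric positive semidefinite, the first $t-1$ entries of $\mu_t$ form $\mu_{t-1}$, and the upper left $(t-1)\times(t-1)$ block of $\mathbf{T}_t$ is $\mathbf{T}_{t-1}$. Let $\Phi_t=[\phi(a_1),\dots,\phi(a_t)]^\top\in\mathbb{R}^{t\times d}$ and $\mathbf{r}_t=(r_1,\dots,r_t)^\top$. For $\delta\in(0,1)$, $\alpha>0$ and $t\ge0$ (with empty vectors and matrices for $t=0$) put $$R_{\mathrm{MM},t}^2=(\mu_t-\mathbf{r}_t)^\top\Big(I+\tfrac{\mathbf{T}_t}{\sigma^2}\Big)^{-1}(\mu_t-\mathbf{r}_t)+\sigma^2\ln\det\Big(I+\tfrac{\mathbf{T}_t}{\sigma^2}\Big)+2\sigma^2\ln\tfrac1\delta,$$ $$\Theta_t=\{\theta\in\mathbb{R}^d:\ \|\Phi_t\theta-\mathbf{r}_t\|_2\le R_{\mathrm{MM},t}\ \text{and}\ \|\theta\|_2\le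 B\},\qquad \widehat\theta_{\alpha,t}=(\Phi_t^\top\Phi_t+\alpha I)^{-1}\Phi_t^\top\mathbf{r}_t,$$ $$R_{\mathrm{AMM},t}^2=R_{\mathrm{MM},t}^2+\alpha B^2-\mathbf{r}_t^\top\mathbf{r}_t+\mathbf{r}_t^\top\Phi_t(\Phi_t^\top\Phi_t+\alpha I)^{-1}\Phi_t^\top\mathbf{r}_t.$$ The algorithm CMM-UCB plays $a_t\in\arg\max_{a\in\mathcal{A}_t}\max_{\theta\in\Theta_{t-1}}\phi(a)^\top\theta$, and AMM-UCB (with parameter $\alpha$) plays $a_t\in\arg\max_{a\in\mathcal{A}_t}\left\{\phi(a)^\top\widehat\theta_{\alpha,t-1}+R_{\mathrm{AMM},t-1}\sqrt{\phi(a)^\top(\Phi_{t-1}^\top\Phi_{t-1}+\alpha I)^{-1}\phi(a)}\right\}$; at outcomes where the quantity to be maximised is undefined ($\Theta_{t-1}=\emptyset$, respectively $R_{\mathrm{AMM},t-1}^2<0$), $a_t\in\mathcal{A}_t$ is arbitrary. Then for every $\delta\in(0,1)$ and every $\alpha>0$, if the actions are those of CMM-UCB, and likewise if they are those of AMM-UCB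 with parameter $\alpha$, the following holds with probability at least $1-\delta$: $R_{\mathrm{AMM},t}^2\ge0$ for all $t\ge0$, and, simultaneously for all $T\ge1$, $$\Delta_{1:T}\le\sum_{t=1}^T2R_{\mathrm{AMM},t-1}\sqrt{\phi(a_t)^\top\left(\Phi_{t-1}^\top\Phi_{t-1}+\alpha I\right)^{-1}\phi(a_t)}.$$ -/

import Mathlib

open MeasureTheory Matrix

/-! Vectors of `ℝⁿ` are functions `Fin n → ℝ`; their Euclidean norm is `‖WithLp.toLp 2 v‖`.
Rounds are numbered from `0`: index `t` stands for round `t + 1`, so that "after `t` rounds" means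
that the data with indices `0, …, t - 1` have been observed. -/

/-- The matrix `Φ_t` whose rows are the first `t` of the feature vectors `x 0, x 1, …`. -/
def designMatrix {d : ℕ} (x : ℕ → Fin d → ℝ) (t : ℕ) : Matrix (Fin t) (Fin d) ℝ :=
  Matrix.of fun i j => x i j

/-- The vector of the first `t` rewards. -/
def rewardVec (r : ℕ → ℝ) (t : ℕ) : Fin t → ℝ := fun i => r i

/-- The squared radius
`R_MM² = (μ - r)ᵀ (1 + S/σ²)⁻¹ (μ - r) + σ² log det (1 + S/σ²) + 2 σ² log (1/δ)`. -/
noncomputable def mmRadiusSq (σ δ : ℝ) {t : ℕ} (m : Fin t → ℝ) (S : Matrix (Fin t) (Fin t) ℝ)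
    (r : Fin t → ℝ) : ℝ :=
  (m - r) ⬝ᵥ ((1 + (σ ^ 2)⁻¹ • S)⁻¹ *ᵥ (m - r))
    + σ ^ 2 * Real.log (1 + (σ ^ 2)⁻¹ • S).det + 2 * σ ^ 2 * Real.log (1 / δ)

/-- The confidence set `{θ | ‖Φ θ - r‖₂ ≤ R and ‖θ‖₂ ≤ B}`. -/
def confSet {t d : ℕ} (Φ : Matrix (Fin t) (Fin d) ℝ) (r : Fin t → ℝ) (R B : ℝ) :
    Set (Fin d → ℝ) :=
  {θ | ‖WithLp.toLp 2 (Φ *ᵥ θ - r)‖ ≤ R ∧ ‖WithLp.toLp 2 θ‖ ≤ B}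

/-- The upper confidence bound `max_{θ ∈ Θ} xᵀ θ` at the feature vector `x`
(a maximum whenever `Θ` is nonempty and compact). -/
noncomputable def ucb {d : ℕ} (Θ : Set (Fin d → ℝ)) (x : Fin d → ℝ) : ℝ :=
  sSup ((fun θ => x ⬝ᵥ θ) '' Θ)

/-- The regularised Gram matrix `Φᵀ Φ + α 1`. -/
def regGram {t d : ℕ} (α : ℝ) (Φ : Matrix (Fin t) (Fin d) ℝ) : Matrix (Fin d) (Fin d) ℝ :=
  Φᵀ * Φ + α • (1 : Matrix (Fin d) (Fin d) ℝ)

/-- The regularised least squares estimate `(Φᵀ Φ + α 1)⁻¹ Φᵀ r`. -/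
noncomputable def ridge {t d : ℕ} (α : ℝ) (Φ : Matrix (Fin t) (Fin d) ℝ) (r : Fin t → ℝ) :
    Fin d → ℝ :=
  (regGram α Φ)⁻¹ *ᵥ (Φᵀ *ᵥ r)

/-- The norm `√(xᵀ (Φᵀ Φ + α 1)⁻¹ x)`. -/
noncomputable def gramNorm {t d : ℕ} (α : ℝ) (Φ : Matrix (Fin t) (Fin d) ℝ) (x : Fin d → ℝ) : ℝ :=
  √(x ⬝ᵥ ((regGram α Φ)⁻¹ *ᵥ x))

/-- The squared radius `R_AMM² = R_MM² + α B² - rᵀ r + rᵀ Φ (Φᵀ Φ + α 1)⁻¹ Φᵀ r`, as a function of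
`R2 = R_MM²`. -/
noncomputable def ammRadiusSq {t d : ℕ} (α B R2 : ℝ) (Φ : Matrix (Fin t) (Fin d) ℝ)
    (r : Fin t → ℝ) : ℝ :=
  R2 + α * B ^ 2 - r ⬝ᵥ r + r ⬝ᵥ (Φ *ᵥ ((regGram α Φ)⁻¹ *ᵥ (Φᵀ *ᵥ r)))

/-- `Q` holds with probability at least `p`: it holds throughout a measurable event of probability
at least `p`. -/
def HoldsWithProb {Ω : Type*} [MeasurableSpace Ω] (P : Measure Ω) (p : ℝ) (Q : Ω → Prop) : Prop :=
  ∃ E : Set Ω, MeasurableSet E ∧ ENNReal.ofReal p ≤ P E ∧ ∀ ω ∈ E, Q ω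

/-- The data of a stochastic linear bandit together with the actions that are played in it.
The action sets may vary with the round and with the outcome. -/
structure LinearBandit (Ω 𝒜 : Type*) [MeasurableSpace Ω] [MeasurableSpace 𝒜] (d : ℕ) where
  /-- the feature map `φ` -/
  feature : 𝒜 → Fin d → ℝ
  /-- the unknown parameter `θ*` -/
  param : Fin d → ℝ
  /-- the action set of each round -/
  actionSet : ℕ → Ω → Set 𝒜
  /-- the action played in each round -/
  action : ℕ → Ω → 𝒜
  /-- the noise of each round -/
  noise : ℕ → Ω → ℝ
  measurable_feature : Measurable feature
  measurable_action : ∀ t, Measurable (action t)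
  measurable_noise : ∀ t, Measurable (noise t)

/-- Gaussian mixture distributions `N(μ_t, S_t)` on `ℝᵗ`, `t = 0, 1, 2, …`, with random mean vectors
and random covariance matrices. -/
structure GaussianMixtures (Ω : Type*) where
  /-- the mean vectors -/
  mean : ∀ t : ℕ, Ω → Fin t → ℝ
  /-- the covariance matrices -/
  cov : ∀ t : ℕ, Ω → Matrix (Fin t) (Fin t) ℝ

namespace LinearBandit

variable {Ω 𝒜 : Type*} [MeasurableSpace Ω] [MeasurableSpace 𝒜] {d : ℕ}

/-- The reward `φ(a)ᵀ θ* + ε` of each round. -/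
def reward (b : LinearBandit Ω 𝒜 d) (t : ℕ) (ω : Ω) : ℝ :=
  b.feature (b.action t ω) ⬝ᵥ b.param + b.noise t ω

/-- The σ-algebra generated by the first `t` actions, the first `t` rewards and the action of the
next round. -/
@[reducible] def history (b : LinearBandit Ω 𝒜 d) (t : ℕ) : MeasurableSpace Ω :=
  (⨆ (i : ℕ) (_ : i ≤ t), MeasurableSpace.comap (b.action i) inferInstance) ⊔
    (⨆ (i : ℕ) (_ : i < t), MeasurableSpace.comap (b.reward i) inferInstance)

/-- The noise of each round is conditionally zero-mean and `σ`-sub-Gaussian given the history up to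
and including the choice of the action of that round. -/
structure NoiseSubGaussian (b : LinearBandit Ω 𝒜 d) (P : Measure Ω) (σ : ℝ) : Prop where
  integrable_exp : ∀ (t : ℕ) (l : ℝ), Integrable (fun ω => Real.exp (l * b.noise t ω)) P
  condExp_eq_zero : ∀ t : ℕ, P[b.noise t | b.history t] =ᵐ[P] 0
  condExp_exp_le : ∀ (t : ℕ) (l : ℝ),
    P[fun ω => Real.exp (l * b.noise t ω) | b.history t]
      ≤ᵐ[P] fun _ => Real.exp (l ^ 2 * σ ^ 2 / 2)

/-- The Gaussian distributions form an adaptive sequence of mixture distributions: the distribution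
on `ℝᵗ⁺¹` depends only on the first `t + 1` actions and the first `t` rewards, the covariance
matrices are positive semidefinite, and the distribution on `ℝᵗ` is the marginal of the one on
`ℝᵗ⁺¹`. -/
structure IsAdaptive (b : LinearBandit Ω 𝒜 d) (N : GaussianMixtures Ω) : Prop where
  measurable_mean : ∀ (t : ℕ) (i : Fin (t + 1)),
    Measurable[b.history t] fun ω => N.mean (t + 1) ω i
  measurable_cov : ∀ (t : ℕ) (i j : Fin (t + 1)),
    Measurable[b.history t] fun ω => N.cov (t + 1) ω i j
  posSemidef_cov : ∀ (t : ℕ) (ω : Ω), (N.cov t ω).PosSemidef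
  mean_castSucc : ∀ (t : ℕ) (ω : Ω) (i : Fin t), N.mean (t + 1) ω i.castSucc = N.mean t ω i
  cov_castSucc : ∀ (t : ℕ) (ω : Ω) (i j : Fin t),
    N.cov (t + 1) ω i.castSucc j.castSucc = N.cov t ω i j

/-- The matrix `Φ_t` of the features of the first `t` actions. -/
def design (b : LinearBandit Ω 𝒜 d) (t : ℕ) (ω : Ω) : Matrix (Fin t) (Fin d) ℝ :=
  designMatrix (fun i => b.feature (b.action i ω)) t

/-- The vector `r_t` of the first `t` rewards. -/
def rewards (b : LinearBandit Ω 𝒜 d) (t : ℕ) (ω : Ω) : Fin t → ℝ :=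
  rewardVec (fun i => b.reward i ω) t

/-- `R_{MM,t}²` -/
noncomputable def mmRadSq (b : LinearBandit Ω 𝒜 d) (N : GaussianMixtures Ω) (σ δ : ℝ) (t : ℕ)
    (ω : Ω) : ℝ :=
  mmRadiusSq σ δ (N.mean t ω) (N.cov t ω) (b.rewards t ω)

/-- The confidence set `Θ_t` after `t` rounds. -/
noncomputable def conf (b : LinearBandit Ω 𝒜 d) (N : GaussianMixtures Ω) (σ δ B : ℝ) (t : ℕ)
    (ω : Ω) : Set (Fin d → ℝ) :=
  confSet (b.design t ω) (b.rewards t ω) √(b.mmRadSq N σ δ t ω) B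

/-- `R_{AMM,t}²` -/
noncomputable def ammRadSq (b : LinearBandit Ω 𝒜 d) (N : GaussianMixtures Ω) (σ δ B α : ℝ) (t : ℕ)
    (ω : Ω) : ℝ :=
  ammRadiusSq α B (b.mmRadSq N σ δ t ω) (b.design t ω) (b.rewards t ω)

/-- The analytic upper confidence bound after `t` rounds, at the action `a`. -/
noncomputable def aucb (b : LinearBandit Ω 𝒜 d) (N : GaussianMixtures Ω) (σ δ B α : ℝ) (t : ℕ)
    (ω : Ω) (a : 𝒜) : ℝ :=
  b.feature a ⬝ᵥ ridge α (b.design t ω) (b.rewards t ω)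
    + √(b.ammRadSq N σ δ B α t ω) * gramNorm α (b.design t ω) (b.feature a)

/-- The actions are those of CMM-UCB: almost surely, in each round, the action lies in the action
set and maximises there the UCB of the current confidence set. (No rule is imposed at outcomes
where that set is empty, for which the UCB is undefined.) -/
def IsCMMUCB (b : LinearBandit Ω 𝒜 d) (P : Measure Ω) (N : GaussianMixtures Ω) (σ δ B : ℝ) :
    Prop :=
  ∀ᵐ ω ∂P, ∀ t : ℕ, b.action t ω ∈ b.actionSet t ω ∧
    ((b.conf N σ δ B t ω).Nonempty →
      IsMaxOn (fun a => ucb (b.conf N σ δ B t ω) (b.feature a)) (b.actionSet t ω) (b.action t ω))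

/-- The actions are those of AMM-UCB with regularisation parameter `α`: almost surely, in each
round, the action lies in the action set and maximises there the current analytic UCB. (No rule is
imposed at outcomes where `R_AMM²` is negative, for which the analytic UCB is undefined.) -/
def IsAMMUCB (b : LinearBandit Ω 𝒜 d) (P : Measure Ω) (N : GaussianMixtures Ω) (σ δ B α : ℝ) :
    Prop :=
  ∀ᵐ ω ∂P, ∀ t : ℕ, b.action t ω ∈ b.actionSet t ω ∧
    (0 ≤ b.ammRadSq N σ δ B α t ω →
      IsMaxOn (b.aucb N σ δ B α t ω) (b.actionSet t ω) (b.action t ω))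

/-- `aStar` selects, almost surely and in each round, an action of the action set with the largest
expected reward. -/
def IsOptimal (b : LinearBandit Ω 𝒜 d) (P : Measure Ω) (aStar : ℕ → Ω → 𝒜) : Prop :=
  ∀ᵐ ω ∂P, ∀ t : ℕ, aStar t ω ∈ b.actionSet t ω ∧
    IsMaxOn (fun a => b.feature a ⬝ᵥ b.param) (b.actionSet t ω) (aStar t ω)

/-- The cumulative regret of the first `T` rounds, with `aStar` the optimal actions. -/
def cumRegret (b : LinearBandit Ω 𝒜 d) (aStar : ℕ → Ω → 𝒜) (T : ℕ) (ω : Ω) : ℝ :=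
  ∑ t ∈ Finset.range T,
    (b.feature (aStar t ω) ⬝ᵥ b.param - b.feature (b.action t ω) ⬝ᵥ b.param)

/-- The data-dependent bound `∑_{t=1}^T 2 R_{AMM,t-1} √(φ(a_t)ᵀ (Φ_{t-1}ᵀ Φ_{t-1} + α 1)⁻¹ φ(a_t))`.
-/
noncomputable def regretBound (b : LinearBandit Ω 𝒜 d) (N : GaussianMixtures Ω) (σ δ B α : ℝ)
    (T : ℕ) (ω : Ω) : ℝ :=
  ∑ t ∈ Finset.range T,
    2 * √(b.ammRadSq N σ δ B α t ω) * gramNorm α (b.design t ω) (b.feature (b.action t ω))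

end LinearBandit

/-! ### Bordered matrices -/

/-! The proof combines a time-uniform concentration bound with optimism.

Concentration. The residual `Φ_t θ* - r_t` is minus the noise vector. For a fixed guess `f` of the
mean rewards, `exp ((‖ε‖² - ‖f - r‖²) / (2σ²))` is the product of the factors `exp (u_i ε_i - u_i²
σ² / 2)` with `u_i = (f_i - φ(a_i)ᵀ θ*) / σ²`, each of conditional mean at most `1`. Averaging over
`f ~ N(μ_t, T_t)` turns it into `exp ((‖ε‖² - R²) / (2σ²))`, with `R²` the value of `R_MM²` at `δ =
1`. The marginals being consistent, this mixture is a nonnegative supermartingale started at `1`,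
and Ville's inequality at level `1/δ` puts `θ*` in every `Θ_t` with probability at least `1 - δ`.
The `t`-dimensional integral is never computed: a Schur complement gives the one-step recurrence
`mmRadiusSq_succ`, and each increment is a one-dimensional Gaussian mixture, treated in
`lintegral_mul_exp_mixture_le`.

Regret. Completing the square (`ridge_completeSquare`) encloses `Θ_t` in an ellipsoid of squared
radius `R_AMM²` about the ridge estimate, which is nonempty once `θ*` lies in it. Cauchy–Schwarz
bounds its width in direction `φ(a)`. Under either rule the analytic UCB of the played action
dominates the optimal expected reward, so the regret of a round is at most twice this half-width. -/

theorem Fin.dotProduct_castSucc {n : ℕ} (u v : Fin (n + 1) → ℝ) :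
    u ⬝ᵥ v = (fun i : Fin n => u i.castSucc) ⬝ᵥ (fun i => v i.castSucc)
      + u (Fin.last n) * v (Fin.last n) := by
  simp only [dotProduct, Fin.sum_univ_castSucc]

/-- The Schur complement formula for the determinant of a matrix bordered by one row and column. -/
theorem Matrix.det_bordered {n : ℕ} (K : Matrix (Fin (n + 1)) (Fin (n + 1)) ℝ)
    (h : IsUnit (K.submatrix Fin.castSucc Fin.castSucc).det) :
    K.det = (K.submatrix Fin.castSucc Fin.castSucc).det *
      (K (Fin.last n) (Fin.last n) - (fun j : Fin n => K (Fin.last n) j.castSucc) ⬝ᵥ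
        ((K.submatrix Fin.castSucc Fin.castSucc)⁻¹ *ᵥ fun i => K i.castSucc (Fin.last n))) := by
  have := Matrix.invertibleOfIsUnitDet _ h
  have e : K.submatrix finSumFinEquiv finSumFinEquiv =
      fromBlocks (K.submatrix Fin.castSucc Fin.castSucc)
        (replicateCol (Fin 1) fun i => K i.castSucc (Fin.last n))
        (replicateRow (Fin 1) fun j => K (Fin.last n) j.castSucc)
        (of fun _ _ => K (Fin.last n) (Fin.last n)) := by
    ext i j
    rcases i with i | i <;> rcases j with j | j <;>
      simp [Fin.castSucc, Fin.last, Fin.natAdd, Fin.fin_one_eq_zero]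
  rw [← det_submatrix_equiv_self finSumFinEquiv K, e, det_fromBlocks₁₁, det_fin_one]
  congr 1
  rw [sub_apply, of_apply, Matrix.mul_assoc, invOf_eq_nonsing_inv]
  rfl

/-- The inverse quadratic form of a symmetric matrix bordered by one row and column. -/
theorem Matrix.dotProduct_inv_mulVec_bordered {n : ℕ} (K : Matrix (Fin (n + 1)) (Fin (n + 1)) ℝ)
    (hK : K.IsHermitian) (h : IsUnit (K.submatrix Fin.castSucc Fin.castSucc).det)
    (h' : IsUnit K.det) (v : Fin (n + 1) → ℝ) (w : Fin n → ℝ) (s : ℝ)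
    (hw : w = (K.submatrix Fin.castSucc Fin.castSucc)⁻¹ *ᵥ fun i => K i.castSucc (Fin.last n))
    (hs : s = K (Fin.last n) (Fin.last n) - (fun j : Fin n => K j.castSucc (Fin.last n)) ⬝ᵥ w)
    (hs0 : s ≠ 0) :
    v ⬝ᵥ (K⁻¹ *ᵥ v) = (fun i : Fin n => v i.castSucc) ⬝ᵥ
        ((K.submatrix Fin.castSucc Fin.castSucc)⁻¹ *ᵥ fun i => v i.castSucc)
      + (v (Fin.last n) - w ⬝ᵥ fun i => v i.castSucc) ^ 2 / s := by
  set K₀ := K.submatrix Fin.castSucc Fin.castSucc with hK₀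
  set c : Fin n → ℝ := fun i => K i.castSucc (Fin.last n) with hc
  set v₀ : Fin n → ℝ := fun i => v i.castSucc with hv₀
  set u : Fin n → ℝ := K₀⁻¹ *ᵥ v₀ with hu
  set z := (v (Fin.last n) - w ⬝ᵥ v₀) / s with hz
  have hK₀T : K₀⁻¹ᵀ = K₀⁻¹ := by
    rw [transpose_nonsing_inv]
    congr 1
    exact (hK.submatrix Fin.castSucc)
  have hKw : K₀ *ᵥ w = c := by rw [hw, mulVec_mulVec, mul_nonsing_inv _ h, one_mulVec]
  have hKu : K₀ *ᵥ u = v₀ := by rw [hu, mulVec_mulVec, mul_nonsing_inv _ h, one_mulVec]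
  have hcu : c ⬝ᵥ u = w ⬝ᵥ v₀ := by
    rw [hu, hw, dotProduct_mulVec, ← mulVec_transpose, hK₀T]
  -- Block elimination for `K y = v`: the last unknown is the eliminated right-hand side divided by
  -- the Schur complement, and back substitution gives the others.
  let y : Fin (n + 1) → ℝ := Fin.snoc (α := fun _ => ℝ) (u - z • w) z
  have hy₀ : (fun i : Fin n => y i.castSucc) = u - z • w := by
    ext i; simp [y]
  have hyl : y (Fin.last n) = z := by simp [y]
  have hKy : K *ᵥ y = v := by
    ext i
    rw [mulVec, Fin.dotProduct_castSucc, hy₀, hyl]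
    refine Fin.lastCases ?_ (fun i => ?_) i
    · have : (fun j : Fin n => K (Fin.last n) j.castSucc) = c := by
        ext j
        simpa using (hK.apply (Fin.last n) j.castSucc).symm
      rw [this, dotProduct_sub, dotProduct_smul, hcu]
      have : z * s = v (Fin.last n) - w ⬝ᵥ v₀ := by rw [hz]; field_simp
      rw [hs] at this
      rw [smul_eq_mul]
      linarith
    · have : (fun j : Fin n => K i.castSucc j.castSucc) ⬝ᵥ (u - z • w) = (K₀ *ᵥ (u - z • w)) i := rfl
      rw [this, mulVec_sub, mulVec_smul, hKw, hKu]
      simp [hc, hv₀]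
      ring
  have : K⁻¹ *ᵥ v = y := by
    rw [← hKy, mulVec_mulVec, nonsing_inv_mul _ h', one_mulVec]
  rw [this, Fin.dotProduct_castSucc, hy₀, hyl, dotProduct_sub, dotProduct_smul, smul_eq_mul,
    dotProduct_comm _ w]
  change v₀ ⬝ᵥ u - z * (w ⬝ᵥ v₀) + _ = _
  rw [hz]
  ring

/-- The Schur complement of `1 + S` at its last entry is at least `1`, for `S` positive
semidefinite. -/
theorem Matrix.PosSemidef.one_le_schur {n : ℕ} {S : Matrix (Fin (n + 1)) (Fin (n + 1)) ℝ}
    (hS : S.PosSemidef) (w : Fin n → ℝ)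
    (hw : (1 + S.submatrix Fin.castSucc Fin.castSucc) *ᵥ w =
      fun i : Fin n => S i.castSucc (Fin.last n)) :
    1 ≤ 1 + S (Fin.last n) (Fin.last n) - (fun i : Fin n => S i.castSucc (Fin.last n)) ⬝ᵥ w := by
  set c : Fin n → ℝ := fun i => S i.castSucc (Fin.last n) with hc
  have hSw : S.submatrix Fin.castSucc Fin.castSucc *ᵥ w = c - w := by
    rw [← hw, add_mulVec, one_mulVec]; simp
  -- Testing positivity on `(-w, 1)` gives `S_nn - cᵀ w ≥ wᵀ w`, where `S_nn` is the last diagonal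
  -- entry.
  let y : Fin (n + 1) → ℝ := Fin.snoc (α := fun _ => ℝ) (-w) 1
  have hy₀ : (fun i : Fin n => y i.castSucc) = -w := by
    ext i; simp [y]
  have hyl : y (Fin.last n) = 1 := by simp [y]
  have hrow : (fun j : Fin n => S (Fin.last n) j.castSucc) = c := by
    ext j
    simpa using (hS.isHermitian.apply (Fin.last n) j.castSucc).symm
  have h := hS.dotProduct_mulVec_nonneg y
  rw [star_trivial, Fin.dotProduct_castSucc, hy₀, hyl] at h
  have e₁ : (S *ᵥ y) (Fin.last n) = -(c ⬝ᵥ w) + S (Fin.last n) (Fin.last n) := by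
    rw [mulVec, Fin.dotProduct_castSucc, hy₀, hyl, hrow, dotProduct_neg, mul_one]
  have e₂ : (fun i : Fin n => (S *ᵥ y) i.castSucc) = w := by
    ext i
    rw [mulVec, Fin.dotProduct_castSucc, hy₀, hyl]
    have : (fun j : Fin n => S i.castSucc j.castSucc) ⬝ᵥ (-w) =
      (S.submatrix Fin.castSucc Fin.castSucc *ᵥ (-w)) i := rfl
    rw [this, mulVec_neg, hSw]
    simp [hc]
  rw [e₁, e₂, neg_dotProduct] at h
  have : 0 ≤ w ⬝ᵥ w := by simpa using dotProduct_star_self_nonneg w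
  linarith

/-- The recurrence of the squared radius of Gaussian mixtures. -/
theorem mmRadiusSq_succ {n : ℕ} (σ δ : ℝ) (m r : Fin (n + 1) → ℝ)
    (S : Matrix (Fin (n + 1)) (Fin (n + 1)) ℝ) (hS : S.PosSemidef) (w : Fin n → ℝ) (s : ℝ)
    (hw : w = (1 + (σ ^ 2)⁻¹ • S.submatrix Fin.castSucc Fin.castSucc)⁻¹ *ᵥ
      fun i => (σ ^ 2)⁻¹ * S i.castSucc (Fin.last n))
    (hs : s = 1 + (σ ^ 2)⁻¹ * S (Fin.last n) (Fin.last n) -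
      (fun i : Fin n => (σ ^ 2)⁻¹ * S i.castSucc (Fin.last n)) ⬝ᵥ w) :
    1 ≤ s ∧ mmRadiusSq σ δ m S r =
      mmRadiusSq σ δ (fun i : Fin n => m i.castSucc) (S.submatrix Fin.castSucc Fin.castSucc)
        (fun i => r i.castSucc)
      + (m (Fin.last n) - r (Fin.last n) - w ⬝ᵥ fun i => m i.castSucc - r i.castSucc) ^ 2 / s
      + σ ^ 2 * Real.log s := by
  have hS' : ((σ ^ 2)⁻¹ • S).PosSemidef := hS.smul (by positivity)
  have hK : (1 + (σ ^ 2)⁻¹ • S).PosDef := PosDef.one.add_posSemidef hS'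
  have hK₀ : (1 + (σ ^ 2)⁻¹ • S.submatrix Fin.castSucc Fin.castSucc).PosDef :=
    PosDef.one.add_posSemidef (hS'.submatrix Fin.castSucc)
  have hdet₀ := hK₀.det_pos
  have hsub : (1 + (σ ^ 2)⁻¹ • S).submatrix (Fin.castSucc : Fin n → _) Fin.castSucc =
      1 + (σ ^ 2)⁻¹ • S.submatrix Fin.castSucc Fin.castSucc := by
    ext i j
    simp [Matrix.one_apply]
  have hcol : (fun i : Fin n => (1 + (σ ^ 2)⁻¹ • S) i.castSucc (Fin.last n)) =
      fun i => (σ ^ 2)⁻¹ * S i.castSucc (Fin.last n) := by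
    ext i
    simp [(Fin.castSucc_lt_last i).ne]
  have hrow : (fun i : Fin n => (1 + (σ ^ 2)⁻¹ • S) (Fin.last n) i.castSucc) =
      fun i => (σ ^ 2)⁻¹ * S i.castSucc (Fin.last n) := by
    ext i
    simpa [Matrix.one_apply, (Fin.castSucc_lt_last i).ne'] using
      Or.inl (hS.isHermitian.apply (Fin.last n) i.castSucc).symm
  have hll : (1 + (σ ^ 2)⁻¹ • S) (Fin.last n) (Fin.last n) =
      1 + (σ ^ 2)⁻¹ * S (Fin.last n) (Fin.last n) := by
    simp
  have h1 : 1 ≤ s := by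
    rw [hs]
    refine hS'.one_le_schur w ?_
    rw [hw]
    have : (1 + ((σ ^ 2)⁻¹ • S).submatrix (Fin.castSucc : Fin n → _) Fin.castSucc) =
      1 + (σ ^ 2)⁻¹ • S.submatrix Fin.castSucc Fin.castSucc := rfl
    rw [this, mulVec_mulVec, mul_nonsing_inv _ hdet₀.ne'.isUnit, one_mulVec]
    rfl
  refine ⟨h1, ?_⟩
  have hd := Matrix.det_bordered (1 + (σ ^ 2)⁻¹ • S) (by rw [hsub]; exact hdet₀.ne'.isUnit)
  rw [hsub, hcol, hrow, hll, ← hw, ← hs] at hd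
  have hq := Matrix.dotProduct_inv_mulVec_bordered (1 + (σ ^ 2)⁻¹ • S) hK.isHermitian
    (by rw [hsub]; exact hdet₀.ne'.isUnit) hK.det_pos.ne'.isUnit (m - r) w s
    (by rw [hsub, hcol]; exact hw) (by rw [hcol, hll]; exact hs) (by positivity)
  rw [hsub] at hq
  unfold mmRadiusSq
  rw [hq, hd, Real.log_mul hdet₀.ne' (by positivity)]
  have e₁ : (fun i : Fin n => (m - r) i.castSucc) =
    (fun i => m i.castSucc) - fun i => r i.castSucc := rfl
  have e₂ : (fun i : Fin n => m i.castSucc - r i.castSucc) =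
    (fun i => m i.castSucc) - fun i => r i.castSucc := rfl
  rw [e₁, e₂, Pi.sub_apply]
  ring

/-! ### The regularised least squares estimate -/

section Ridge

variable {t d : ℕ} {α : ℝ} (Φ : Matrix (Fin t) (Fin d) ℝ)

theorem regGram_posDef (hα : 0 < α) : (regGram α Φ).PosDef := by
  unfold regGram
  rw [add_comm]
  refine (PosDef.one.smul hα).add_posSemidef ?_
  simpa using posSemidef_conjTranspose_mul_self Φ

theorem dotProduct_regGram_mulVec (u v : Fin d → ℝ) :
    u ⬝ᵥ (regGram α Φ *ᵥ v) = (Φ *ᵥ u) ⬝ᵥ (Φ *ᵥ v) + α * (u ⬝ᵥ v) := by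
  rw [regGram, add_mulVec, dotProduct_add, ← mulVec_mulVec, dotProduct_mulVec, vecMul_transpose,
    smul_mulVec, one_mulVec, dotProduct_smul, smul_eq_mul]

theorem regGram_mulVec_ridge (hα : 0 < α) (r : Fin t → ℝ) :
    regGram α Φ *ᵥ ridge α Φ r = Φᵀ *ᵥ r := by
  rw [ridge, mulVec_mulVec, mul_nonsing_inv _ (regGram_posDef Φ hα).det_pos.ne'.isUnit, one_mulVec]

/-- Completing the square in the regularised least squares objective. -/
theorem ridge_completeSquare (hα : 0 < α) (r : Fin t → ℝ) (θ : Fin d → ℝ) :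
    (θ - ridge α Φ r) ⬝ᵥ (regGram α Φ *ᵥ (θ - ridge α Φ r)) =
      (Φ *ᵥ θ - r) ⬝ᵥ (Φ *ᵥ θ - r) + α * (θ ⬝ᵥ θ) - r ⬝ᵥ r
        + r ⬝ᵥ (Φ *ᵥ ((regGram α Φ)⁻¹ *ᵥ (Φᵀ *ᵥ r))) := by
  change _ = _ + r ⬝ᵥ (Φ *ᵥ ridge α Φ r)
  have h₁ : ∀ u : Fin d → ℝ, u ⬝ᵥ (Φᵀ *ᵥ r) = (Φ *ᵥ u) ⬝ᵥ r := fun u => by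
    rw [dotProduct_mulVec, vecMul_transpose]
  have h₂ : ridge α Φ r ⬝ᵥ (regGram α Φ *ᵥ θ) = (Φ *ᵥ θ) ⬝ᵥ r := by
    rw [dotProduct_regGram_mulVec, dotProduct_comm (Φ *ᵥ _), dotProduct_comm _ θ,
      ← dotProduct_regGram_mulVec, regGram_mulVec_ridge Φ hα, h₁]
  rw [mulVec_sub, sub_dotProduct, dotProduct_sub, dotProduct_sub, h₂, regGram_mulVec_ridge Φ hα, h₁,
    h₁, dotProduct_regGram_mulVec, sub_dotProduct, dotProduct_sub, dotProduct_sub,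
    dotProduct_comm r (Φ *ᵥ θ), dotProduct_comm r (Φ *ᵥ ridge α Φ r)]
  ring

theorem norm_toLp_sq {n : ℕ} (v : Fin n → ℝ) : ‖WithLp.toLp 2 v‖ ^ 2 = v ⬝ᵥ v := by
  rw [EuclideanSpace.norm_sq_eq]
  simp [dotProduct, sq]

/-- The Cauchy–Schwarz inequality for a positive definite form and its inverse. -/
theorem Matrix.PosDef.sq_dotProduct_le {V : Matrix (Fin d) (Fin d) ℝ} (hV : V.PosDef)
    (x u : Fin d → ℝ) : (x ⬝ᵥ u) ^ 2 ≤ (x ⬝ᵥ (V⁻¹ *ᵥ x)) * (u ⬝ᵥ (V *ᵥ u)) := by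
  set y := V⁻¹ *ᵥ x with hy
  have hVy : V *ᵥ y = x := by
    rw [hy, mulVec_mulVec, mul_nonsing_inv _ hV.det_pos.ne'.isUnit, one_mulVec]
  have hsymm : ∀ a b : Fin d → ℝ, a ⬝ᵥ (V *ᵥ b) = b ⬝ᵥ (V *ᵥ a) := fun a b => by
    have : Vᵀ = V := hV.isHermitian
    rw [dotProduct_mulVec, ← mulVec_transpose, this, dotProduct_comm]
  -- The form `V` at `c y - u` is a nonnegative quadratic in `c`; its discriminant is the claim.
  have key : ∀ c : ℝ, 0 ≤ (x ⬝ᵥ y) * (c * c) + (-2 * (x ⬝ᵥ u)) * c + u ⬝ᵥ (V *ᵥ u) := fun c => by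
    have h := hV.posSemidef.dotProduct_mulVec_nonneg (c • y - u)
    rw [star_trivial, mulVec_sub, mulVec_smul, hVy, sub_dotProduct, dotProduct_sub, dotProduct_sub,
      smul_dotProduct, smul_dotProduct, dotProduct_smul, dotProduct_smul, hsymm y u, hVy,
      dotProduct_comm y x, dotProduct_comm u x] at h
    simp only [smul_eq_mul] at h
    linarith
  have := discrim_le_zero key
  rw [discrim] at this
  linarith

/-- Adding the fit constraint to `α` times the norm constraint relaxes the intersection of the two
to a single ellipsoid. -/
theorem ammRadiusSq_bound (hα : 0 < α) {B R2 : ℝ} (r : Fin t → ℝ) {θ : Fin d → ℝ} (hR : 0 ≤ R2)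
    (hθ : θ ∈ confSet Φ r √R2 B) :
    (θ - ridge α Φ r) ⬝ᵥ (regGram α Φ *ᵥ (θ - ridge α Φ r)) ≤ ammRadiusSq α B R2 Φ r := by
  rw [ridge_completeSquare Φ hα, ammRadiusSq, ← norm_toLp_sq (Φ *ᵥ θ - r), ← norm_toLp_sq θ]
  have h₁ : ‖WithLp.toLp 2 (Φ *ᵥ θ - r)‖ ^ 2 ≤ R2 := by
    rw [← Real.sq_sqrt hR]
    exact pow_le_pow_left₀ (norm_nonneg _) hθ.1 2
  have h₂ : ‖WithLp.toLp 2 θ‖ ^ 2 ≤ B ^ 2 := pow_le_pow_left₀ (norm_nonneg _) hθ.2 2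
  have h₃ := mul_le_mul_of_nonneg_left h₂ hα.le
  linarith

theorem ammRadiusSq_nonneg (hα : 0 < α) {B R2 : ℝ} (r : Fin t → ℝ) {θ : Fin d → ℝ} (hR : 0 ≤ R2)
    (hθ : θ ∈ confSet Φ r √R2 B) : 0 ≤ ammRadiusSq α B R2 Φ r :=
  ((regGram_posDef Φ hα).posSemidef.dotProduct_mulVec_nonneg (θ - ridge α Φ r)).trans
    (ammRadiusSq_bound Φ hα r hR hθ)

theorem abs_dotProduct_sub_ridge_le (hα : 0 < α) {B R2 : ℝ} (r : Fin t → ℝ) {θ : Fin d → ℝ}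
    (hR : 0 ≤ R2) (hθ : θ ∈ confSet Φ r √R2 B) (x : Fin d → ℝ) :
    |x ⬝ᵥ θ - x ⬝ᵥ ridge α Φ r| ≤ √(ammRadiusSq α B R2 Φ r) * gramNorm α Φ x := by
  have hx : 0 ≤ x ⬝ᵥ ((regGram α Φ)⁻¹ *ᵥ x) := by
    simpa using (regGram_posDef Φ hα).inv.posSemidef.dotProduct_mulVec_nonneg x
  rw [← dotProduct_sub, gramNorm, ← Real.sqrt_mul (ammRadiusSq_nonneg Φ hα r hR hθ)]
  refine Real.abs_le_sqrt (((regGram_posDef Φ hα).sq_dotProduct_le x _).trans ?_)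
  rw [mul_comm]
  exact mul_le_mul_of_nonneg_right (ammRadiusSq_bound Φ hα r hR hθ) hx

/-- The analytic bound serves only to show that the set is bounded above, without which `sSup` would
be a junk value; any `α > 0` would do. -/
theorem le_ucb_of_mem (hα : 0 < α) {B R2 : ℝ} (r : Fin t → ℝ) {θ : Fin d → ℝ}
    (hR : 0 ≤ R2) (hθ : θ ∈ confSet Φ r √R2 B) (x : Fin d → ℝ) :
    x ⬝ᵥ θ ≤ ucb (confSet Φ r √R2 B) x := by
  refine le_csSup ⟨x ⬝ᵥ ridge α Φ r + √(ammRadiusSq α B R2 Φ r) * gramNorm α Φ x, ?_⟩ ⟨θ, hθ, rfl⟩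
  rintro _ ⟨η, hη, rfl⟩
  have := (abs_le.mp (abs_dotProduct_sub_ridge_le Φ hα r hR hη x)).2
  simp only
  linarith

theorem ucb_confSet_le (hα : 0 < α) {B R2 : ℝ} (r : Fin t → ℝ) (hR : 0 ≤ R2)
    (hne : (confSet Φ r √R2 B).Nonempty) (x : Fin d → ℝ) :
    ucb (confSet Φ r √R2 B) x ≤
      x ⬝ᵥ ridge α Φ r + √(ammRadiusSq α B R2 Φ r) * gramNorm α Φ x := by
  refine csSup_le (hne.image _) ?_
  rintro _ ⟨η, hη, rfl⟩
  have := (abs_le.mp (abs_dotProduct_sub_ridge_le Φ hα r hR hη x)).2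
  simp only
  linarith

end Ridge

/-! ### Measurability of matrix operations -/

section Measurability

variable {Ω : Type*} {mΩ : MeasurableSpace Ω} {n : ℕ}

theorem measurable_dotProduct {u v : Ω → Fin n → ℝ} (hu : ∀ i, Measurable fun ω => u ω i)
    (hv : ∀ i, Measurable fun ω => v ω i) : Measurable fun ω => u ω ⬝ᵥ v ω :=
  Finset.measurable_sum _ fun i _ => (hu i).mul (hv i)

theorem measurable_det {A : Ω → Matrix (Fin n) (Fin n) ℝ}
    (hA : ∀ i j, Measurable fun ω => A ω i j) : Measurable fun ω => (A ω).det := by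
  simp only [det_apply']
  exact Finset.measurable_sum _ fun p _ =>
    measurable_const.mul (Finset.measurable_prod _ fun i _ => hA _ _)

theorem measurable_inv_apply {A : Ω → Matrix (Fin n) (Fin n) ℝ}
    (hA : ∀ i j, Measurable fun ω => A ω i j) (i j : Fin n) :
    Measurable fun ω => (A ω)⁻¹ i j := by
  simp only [inv_def, Ring.inverse_eq_inv', Matrix.smul_apply, adjugate_apply, smul_eq_mul]
  refine (measurable_det hA).inv.mul (measurable_det fun k l => ?_)
  simp only [updateRow_apply]
  split_ifs
  · exact measurable_const
  · exact hA k l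

theorem measurable_mulVec_apply {A : Ω → Matrix (Fin n) (Fin n) ℝ} {v : Ω → Fin n → ℝ}
    (hA : ∀ i j, Measurable fun ω => A ω i j) (hv : ∀ i, Measurable fun ω => v ω i) (i : Fin n) :
    Measurable fun ω => (A ω *ᵥ v ω) i :=
  measurable_dotProduct (hA i) hv

theorem measurable_one_add_smul {S : Ω → Matrix (Fin n) (Fin n) ℝ} (c : ℝ)
    (hS : ∀ i j, Measurable fun ω => S ω i j) (i j : Fin n) :
    Measurable fun ω => (1 + c • S ω) i j := by
  simp only [Matrix.add_apply, Matrix.smul_apply, smul_eq_mul]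
  exact measurable_const.add (measurable_const.mul (hS i j))

theorem measurable_mmRadiusSq {S : Ω → Matrix (Fin n) (Fin n) ℝ} {m r : Ω → Fin n → ℝ} (σ δ : ℝ)
    (hm : ∀ i, Measurable fun ω => m ω i) (hS : ∀ i j, Measurable fun ω => S ω i j)
    (hr : ∀ i, Measurable fun ω => r ω i) :
    Measurable fun ω => mmRadiusSq σ δ (m ω) (S ω) (r ω) := by
  have hmr : ∀ i, Measurable fun ω => (m ω - r ω) i := fun i => (hm i).sub (hr i)
  have hK := measurable_one_add_smul (σ ^ 2)⁻¹ hS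
  unfold mmRadiusSq
  exact ((measurable_dotProduct hmr (measurable_mulVec_apply (measurable_inv_apply hK) hmr)).add
    (measurable_const.mul (measurable_det hK).log)).add measurable_const

end Measurability

/-! ### Conditionally sub-Gaussian noise and Gaussian mixtures -/

section SubGaussian

open ProbabilityTheory

variable {Ω : Type*} {m mΩ : MeasurableSpace Ω} {P : Measure Ω} [IsProbabilityMeasure P]

/-- On `m`, the measure with density `exp (l ε)` is dominated by `C • P`. Comparing measures lets
`g` be any nonnegative `m`-measurable function, with no integrability. -/
theorem lintegral_mul_exp_const_le (hm : m ≤ mΩ) {ε : Ω → ℝ} (hε : Measurable ε) {l C : ℝ}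
    (hint : Integrable (fun ω => Real.exp (l * ε ω)) P)
    (hC : P[fun ω => Real.exp (l * ε ω) | m] ≤ᵐ[P] fun _ => C)
    {g : Ω → ENNReal} (hg : Measurable[m] g) :
    ∫⁻ ω, g ω * ENNReal.ofReal (Real.exp (l * ε ω)) ∂P ≤ ∫⁻ ω, g ω * ENNReal.ofReal C ∂P := by
  have hexp : Measurable fun ω => ENNReal.ofReal (Real.exp (l * ε ω)) := by fun_prop
  set ν : Measure Ω := P.withDensity fun ω => ENNReal.ofReal (Real.exp (l * ε ω)) with hν
  have hle : ν.trim hm ≤ ENNReal.ofReal C • P.trim hm := by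
    refine Measure.le_intro fun A hA _ => ?_
    rw [Measure.smul_apply, trim_measurableSet_eq hm hA, trim_measurableSet_eq hm hA, hν,
      withDensity_apply _ (hm A hA), ← ofReal_integral_eq_lintegral_ofReal hint.integrableOn
        (Filter.Eventually.of_forall fun _ => (Real.exp_pos _).le), ← setIntegral_condExp hm hint hA]
    calc ENNReal.ofReal (∫ ω in A, (P[fun ω => Real.exp (l * ε ω) | m]) ω ∂P)
        ≤ ENNReal.ofReal (∫ _ in A, C ∂P) := by
          refine ENNReal.ofReal_le_ofReal (integral_mono_ae integrable_condExp.integrableOn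
            (integrable_const C) (ae_restrict_of_ae hC))
      _ = ENNReal.ofReal C • P A := by
          rw [setIntegral_const, smul_eq_mul, mul_comm, smul_eq_mul]
          have : ∀ x : ℝ, ENNReal.ofReal (x * P.real A) = ENNReal.ofReal x * P A := fun x => by
            rw [ENNReal.ofReal_mul' measureReal_nonneg, ofReal_measureReal]
          exact this C
  calc ∫⁻ ω, g ω * ENNReal.ofReal (Real.exp (l * ε ω)) ∂P = ∫⁻ ω, g ω ∂ν := by
        rw [hν, lintegral_withDensity_eq_lintegral_mul _ hexp (hg.mono hm le_rfl)]
        simp only [Pi.mul_apply, mul_comm]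
    _ = ∫⁻ ω, g ω ∂(ν.trim hm) := (lintegral_trim hm hg).symm
    _ ≤ ∫⁻ ω, g ω ∂(ENNReal.ofReal C • P.trim hm) := lintegral_mono' hle le_rfl
    _ = ∫⁻ ω, g ω * ENNReal.ofReal C ∂P := by
        rw [lintegral_smul_measure, lintegral_trim hm hg, lintegral_mul_const _ (hg.mono hm le_rfl),
          smul_eq_mul, mul_comm]

theorem Measurable.exists_tendsto_finite_range {α : Type*} {mα : MeasurableSpace α} {U : α → ℝ}
    (hU : Measurable U) : ∃ A : ℕ → α → ℝ, (∀ k, Measurable (A k)) ∧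
      (∀ k, (Set.range (A k)).Finite) ∧
      ∀ ω, Filter.Tendsto (fun k => A k ω) Filter.atTop (nhds (U ω)) :=
  ⟨fun k => hU.stronglyMeasurable.approx k, fun k => (hU.stronglyMeasurable.approx k).measurable,
    fun k => (hU.stronglyMeasurable.approx k).finite_range, hU.stronglyMeasurable.tendsto_approx⟩

/-- A conditionally sub-Gaussian variable has the sub-Gaussian property also at random multipliers
that are measurable with respect to the conditioning σ-algebra. -/
theorem lintegral_mul_exp_le (hm : m ≤ mΩ) {ε : Ω → ℝ} (hε : Measurable ε) {σ : ℝ}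
    (hint : ∀ l : ℝ, Integrable (fun ω => Real.exp (l * ε ω)) P)
    (hC : ∀ l : ℝ, P[fun ω => Real.exp (l * ε ω) | m] ≤ᵐ[P] fun _ => Real.exp (l ^ 2 * σ ^ 2 / 2))
    {g : Ω → ENNReal} (hg : Measurable[m] g) {U : Ω → ℝ} (hU : Measurable[m] U) :
    ∫⁻ ω, g ω * ENNReal.ofReal (Real.exp (U ω * ε ω - U ω ^ 2 * σ ^ 2 / 2)) ∂P
      ≤ ∫⁻ ω, g ω ∂P := by
  -- For finitely many values the claim splits over the fibres of `V`. On each, the multiplier is a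
  -- constant `l`, and the indicator and `exp (-l² σ² / 2)` are absorbed into `g`.
  have simple : ∀ V : Ω → ℝ, Measurable[m] V → (Set.range V).Finite →
      ∫⁻ ω, g ω * ENNReal.ofReal (Real.exp (V ω * ε ω - V ω ^ 2 * σ ^ 2 / 2)) ∂P
        ≤ ∫⁻ ω, g ω ∂P := by
    intro V hVm hVr
    have hVfib : ∀ l, MeasurableSet[m] (V ⁻¹' {l}) := fun l => hVm (measurableSet_singleton l)
    have split : ∀ f : Ω → ENNReal, Measurable f →
        ∫⁻ ω, f ω ∂P = ∑ l ∈ hVr.toFinset, ∫⁻ ω in V ⁻¹' {l}, f ω ∂P := fun f hf => by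
      rw [← lintegral_biUnion_finset (fun i _ j _ hij => Disjoint.preimage _ (by simpa using hij))
        (fun l _ => hm _ (hVfib l)), ← setLIntegral_univ]
      congr 2
      ext ω
      simp
    have hV : Measurable V := hVm.mono hm le_rfl
    have hprod : Measurable fun ω =>
        g ω * ENNReal.ofReal (Real.exp (V ω * ε ω - V ω ^ 2 * σ ^ 2 / 2)) :=
      (hg.mono hm le_rfl).mul (by fun_prop)
    rw [split _ hprod, split _ (hg.mono hm le_rfl)]
    refine Finset.sum_le_sum fun l _ => ?_
    have hgl : Measurable[m] ((V ⁻¹' {l}).indicator fun ω =>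
        g ω * ENNReal.ofReal (Real.exp (-(l ^ 2 * σ ^ 2 / 2)))) :=
      (hg.mul_const _).indicator (hVfib l)
    have h := lintegral_mul_exp_const_le hm hε (hint l) (hC l) hgl
    calc _ = ∫⁻ ω, (V ⁻¹' {l}).indicator (fun ω =>
          g ω * ENNReal.ofReal (Real.exp (-(l ^ 2 * σ ^ 2 / 2)))) ω
            * ENNReal.ofReal (Real.exp (l * ε ω)) ∂P := by
          rw [← lintegral_indicator (hm _ (hVfib l))]
          refine lintegral_congr fun ω => ?_
          by_cases hω : ω ∈ V ⁻¹' {l}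
          · have : V ω = l := hω
            rw [Set.indicator_of_mem hω, Set.indicator_of_mem hω, this, mul_assoc,
              ← ENNReal.ofReal_mul (Real.exp_pos _).le, ← Real.exp_add]
            congr 3
            ring
          · rw [Set.indicator_of_notMem hω, Set.indicator_of_notMem hω, zero_mul]
      _ ≤ _ := h
      _ = _ := by
          rw [← lintegral_indicator (hm _ (hVfib l))]
          refine lintegral_congr fun ω => ?_
          by_cases hω : ω ∈ V ⁻¹' {l}
          · rw [Set.indicator_of_mem hω, Set.indicator_of_mem hω, mul_assoc,
              ← ENNReal.ofReal_mul (Real.exp_pos _).le, ← Real.exp_add]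
            simp
          · rw [Set.indicator_of_notMem hω, Set.indicator_of_notMem hω, zero_mul]
  obtain ⟨A, hAm, hAr, hAlim⟩ := Measurable.exists_tendsto_finite_range hU
  have hmeas : ∀ k, Measurable fun ω => g ω *
      ENNReal.ofReal (Real.exp (A k ω * ε ω - A k ω ^ 2 * σ ^ 2 / 2)) := fun k => by
    have : Measurable (A k) := (hAm k).mono hm le_rfl
    exact (hg.mono hm le_rfl).mul (by fun_prop)
  have hlim : ∀ ω, Filter.Tendsto (fun k => g ω *
      ENNReal.ofReal (Real.exp (A k ω * ε ω - A k ω ^ 2 * σ ^ 2 / 2)))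
      Filter.atTop (nhds (g ω * ENNReal.ofReal (Real.exp (U ω * ε ω - U ω ^ 2 * σ ^ 2 / 2)))) := by
    intro ω
    -- As `g ω` may be infinite, continuity of the product needs a nonzero limit, which the
    -- exponential provides.
    refine ENNReal.Tendsto.const_mul (ENNReal.tendsto_ofReal ?_) (Or.inl ?_)
    · have h := hAlim ω
      exact (Real.continuous_exp.tendsto _).comp ((h.mul_const _).sub
        (((h.pow 2).mul_const _).div_const _))
    · simp [Real.exp_pos]
  -- Fatou's lemma: the exponentials are neither monotone in `k` nor dominated.
  calc _ = ∫⁻ ω, Filter.liminf (fun k => g ω *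
      ENNReal.ofReal (Real.exp (A k ω * ε ω - A k ω ^ 2 * σ ^ 2 / 2)))
        Filter.atTop ∂P := lintegral_congr fun ω => ((hlim ω).liminf_eq).symm
    _ ≤ Filter.liminf (fun k => ∫⁻ ω, g ω *
      ENNReal.ofReal (Real.exp (A k ω * ε ω - A k ω ^ 2 * σ ^ 2 / 2)) ∂P)
        Filter.atTop := lintegral_liminf_le hmeas
    _ ≤ _ := Filter.liminf_le_of_le (by isBoundedDefault) fun b hb =>
        let ⟨k, hk⟩ := hb.exists
        hk.trans (simple _ (hAm k) (hAr k))

/-- The mixture of the exponentials `exp (u e - u² σ² / 2)` over `u = (g + √(s - 1) σ z) / σ²` with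
`z` standard normal. -/
theorem lintegral_gaussian_mixture {σ : ℝ} (hσ : 0 < σ) (g e : ℝ) {s : ℝ} (hs : 1 ≤ s) :
    ∫⁻ z, ENNReal.ofReal (Real.exp ((g / σ ^ 2 + √(s - 1) * z / σ) * e
        - (g / σ ^ 2 + √(s - 1) * z / σ) ^ 2 * σ ^ 2 / 2)) ∂(gaussianReal 0 1) =
      ENNReal.ofReal (Real.exp ((e ^ 2 - (g - e) ^ 2 / s - σ ^ 2 * Real.log s) / (2 * σ ^ 2))) := by
  have hs0 : 0 < s := by linarith
  set τ := √(s - 1) with hτ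
  have hτ2 : τ ^ 2 = s - 1 := Real.sq_sqrt (by linarith)
  set h := (e - g) / σ with hh
  have hv : (s⁻¹).toNNReal ≠ 0 := (Real.toNNReal_pos.mpr (by positivity)).ne'
  have hsq : √s = Real.exp (Real.log s / 2) := by
    rw [Real.exp_half, Real.exp_log hs0]
  -- Completing the square in `z`: the quadratic coefficient becomes `-(1 + τ²) / 2 = -s / 2`, so
  -- the integrand is a constant times a normal density of variance `1/s`.
  have key : ∀ z : ℝ, gaussianPDF 0 1 z * ENNReal.ofReal (Real.exp ((g / σ ^ 2 + τ * z / σ) * e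
        - (g / σ ^ 2 + τ * z / σ) ^ 2 * σ ^ 2 / 2)) =
      ENNReal.ofReal (Real.exp ((e ^ 2 - (g - e) ^ 2 / s - σ ^ 2 * Real.log s) / (2 * σ ^ 2))) *
        gaussianPDF (h * τ / s) (s⁻¹).toNNReal z := by
    intro z
    simp only [gaussianPDF]
    rw [← ENNReal.ofReal_mul (gaussianPDFReal_nonneg _ _ _),
      ← ENNReal.ofReal_mul (Real.exp_pos _).le]
    congr 1
    simp only [gaussianPDFReal, NNReal.coe_one, mul_one, sub_zero, 
      Real.coe_toNNReal _ (inv_pos.mpr hs0).le]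
    have e₁ : (√(2 * Real.pi * s⁻¹))⁻¹ = (√(2 * Real.pi))⁻¹ * Real.exp (Real.log s / 2) := by
      rw [Real.sqrt_mul (by positivity), Real.sqrt_inv, mul_inv, inv_inv, hsq]
    rw [e₁, mul_assoc, ← Real.exp_add, mul_assoc, mul_left_comm, ← Real.exp_add, ← Real.exp_add]
    congr 2
    have hs' : s = 1 + τ ^ 2 := by linarith
    rw [hh]
    generalize Real.log s = L
    rw [hs']
    have : 1 + τ ^ 2 ≠ 0 := by positivity
    field_simp
    ring
  rw [gaussianReal_of_var_ne_zero _ one_ne_zero,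
    lintegral_withDensity_eq_lintegral_mul _ (measurable_gaussianPDF _ _) (by fun_prop)]
  simp only [Pi.mul_apply]
  rw [lintegral_congr key, lintegral_const_mul _ (measurable_gaussianPDF _ _),
    lintegral_gaussianPDF_eq_one _ hv, mul_one]

/-- A Gaussian mixture with measurable random mean and variance of the sub-Gaussian exponentials. -/
theorem lintegral_mul_exp_mixture_le (hm : m ≤ mΩ) {ε : Ω → ℝ} (hε : Measurable ε) {σ : ℝ}
    (hσ : 0 < σ) (hint : ∀ l : ℝ, Integrable (fun ω => Real.exp (l * ε ω)) P)
    (hC : ∀ l : ℝ, P[fun ω => Real.exp (l * ε ω) | m] ≤ᵐ[P] fun _ => Real.exp (l ^ 2 * σ ^ 2 / 2))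
    {f : Ω → ENNReal} (hf : Measurable[m] f) {g s : Ω → ℝ} (hg : Measurable[m] g)
    (hs : Measurable[m] s) (hs1 : ∀ ω, 1 ≤ s ω) :
    ∫⁻ ω, f ω * ENNReal.ofReal (Real.exp ((ε ω ^ 2 - (g ω - ε ω) ^ 2 / s ω
        - σ ^ 2 * Real.log (s ω)) / (2 * σ ^ 2))) ∂P ≤ ∫⁻ ω, f ω ∂P := by
  have hf' := hf.mono hm le_rfl
  have hg' := hg.mono hm le_rfl
  have hs' := hs.mono hm le_rfl
  calc _ = ∫⁻ ω, ∫⁻ z, f ω * ENNReal.ofReal (Real.exp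
          ((g ω / σ ^ 2 + √(s ω - 1) * z / σ) * ε ω
            - (g ω / σ ^ 2 + √(s ω - 1) * z / σ) ^ 2 * σ ^ 2 / 2)) ∂(gaussianReal 0 1) ∂P := by
        refine lintegral_congr fun ω => ?_
        rw [lintegral_const_mul _ (by fun_prop), lintegral_gaussian_mixture hσ _ _ (hs1 ω)]
    _ = ∫⁻ z, ∫⁻ ω, f ω * ENNReal.ofReal (Real.exp
          ((g ω / σ ^ 2 + √(s ω - 1) * z / σ) * ε ω
            - (g ω / σ ^ 2 + √(s ω - 1) * z / σ) ^ 2 * σ ^ 2 / 2)) ∂P ∂(gaussianReal 0 1) := by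
        refine lintegral_lintegral_swap (Measurable.aemeasurable ?_)
        unfold Function.uncurry
        fun_prop
    _ ≤ ∫⁻ _, ∫⁻ ω, f ω ∂P ∂(gaussianReal 0 1) := by
        -- After the swap `z` is fixed, so the multiplier is `m`-measurable.
        refine lintegral_mono fun z => lintegral_mul_exp_le hm hε hint hC hf ?_
        exact (hg.div_const _).add ((((hs.sub_const 1).sqrt).mul_const z).div_const σ)
    _ = _ := by simp

end SubGaussian

/-! ### Ville's inequality -/

/-- Ville's maximal inequality. -/
theorem measure_exists_le_of_lintegral_succ_le {Ω : Type*} {mΩ : MeasurableSpace Ω} {P : Measure Ω}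
    (F : ℕ → MeasurableSpace Ω) (hF : ∀ n, F n ≤ mΩ) (hmono : Monotone F) (W : ℕ → Ω → ENNReal)
    (hW : ∀ n, Measurable[F n] (W n))
    (hstep : ∀ n A, MeasurableSet[F n] A → ∫⁻ ω in A, W (n + 1) ω ∂P ≤ ∫⁻ ω in A, W n ω ∂P)
    (c : ENNReal) : c * P {ω | ∃ n, c ≤ W n ω} ≤ ∫⁻ ω, W 0 ω ∂P := by
  let N : ℕ → Set Ω := fun n => {ω | ∀ k ≤ n, W k ω < c}
  have hN : ∀ n, MeasurableSet[F n] (N n) := fun n => by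
    have : N n = ⋂ k ≤ n, {ω | W k ω < c} := by ext; simp [N]
    rw [this]
    exact MeasurableSet.iInter fun k => MeasurableSet.iInter fun hk =>
      hmono hk _ (measurableSet_lt (hW k) measurable_const)
  have hN' := fun n => hF n _ (hN n)
  have hanti : ∀ n, N (n + 1) ⊆ N n := fun n ω h k hk => h k (Nat.le_succ_of_le hk)
  -- The left side is a lower bound for the mean of `W` stopped on reaching `c`. The supermartingale
  -- step is needed only on the sets `N n`, where `c` has not been reached.
  have key : ∀ n, c * P (N n)ᶜ + ∫⁻ ω in N n, W n ω ∂P ≤ ∫⁻ ω, W 0 ω ∂P := by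
    intro n
    induction n with
    | zero =>
      rw [← lintegral_add_compl (μ := P) (W 0) (hN' 0), add_comm]
      refine add_le_add le_rfl ?_
      rw [← setLIntegral_const]
      refine setLIntegral_mono' (hN' 0).compl fun ω hω => ?_
      simpa [N] using hω
    | succ n ih =>
      refine le_trans ?_ ih
      have e : (N (n + 1))ᶜ = (N n)ᶜ ∪ (N n \ N (n + 1)) := by
        ext ω
        have := @hanti n ω
        simp only [Set.mem_compl_iff, Set.mem_union, Set.mem_sdiff]
        tauto
      have hd : MeasurableSet (N n \ N (n + 1)) := (hN' n).diff (hN' (n + 1))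
      rw [e, measure_union (Set.disjoint_compl_left_iff_subset.mpr Set.sdiff_subset) hd, mul_add,
        add_assoc]
      refine add_le_add le_rfl (le_trans ?_ (hstep n _ (hN n)))
      have h := lintegral_inter_add_sdiff (μ := P) (W (n + 1)) (N n) (hN' (n + 1))
      rw [Set.inter_eq_right.mpr (hanti n)] at h
      rw [← h, add_comm]
      refine add_le_add le_rfl ?_
      rw [← setLIntegral_const]
      refine setLIntegral_mono' hd fun ω hω => ?_
      by_contra hlt
      refine hω.2 fun k hk => ?_
      rcases Nat.le_succ_iff.mp hk with hk | rfl
      · exact hω.1 k hk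
      · exact not_le.mp hlt
  have hU : {ω | ∃ n, c ≤ W n ω} = ⋃ n, (N n)ᶜ := by
    ext ω
    simp only [Set.mem_ofPred_eq, Set.mem_iUnion, Set.mem_compl_iff, N, not_forall, not_lt]
    exact ⟨fun ⟨n, h⟩ => ⟨n, n, le_rfl, h⟩, fun ⟨_, k, _, h⟩ => ⟨k, h⟩⟩
  have hmon : Monotone fun n => (N n)ᶜ :=
    monotone_nat_of_le_succ fun n => Set.compl_subset_compl.mpr (hanti n)
  rw [hU, hmon.measure_iUnion, ENNReal.mul_iSup]
  exact iSup_le fun n => le_self_add.trans (key n)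

namespace LinearBandit

variable {Ω 𝒜 : Type*} [MeasurableSpace Ω] [MeasurableSpace 𝒜] {d : ℕ}
  (b : LinearBandit Ω 𝒜 d)

/-! ### Measurability with respect to the history -/

theorem measurable_feature_dotProduct : Measurable fun a => b.feature a ⬝ᵥ b.param :=
  measurable_dotProduct (fun i => (measurable_pi_apply i).comp b.measurable_feature)
    fun _ => measurable_const

theorem measurable_reward (t : ℕ) : Measurable (b.reward t) :=
  (b.measurable_feature_dotProduct.comp (b.measurable_action t)).add (b.measurable_noise t)

theorem history_le (t : ℕ) : b.history t ≤ ‹MeasurableSpace Ω› :=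
  sup_le (iSup₂_le fun i _ => (b.measurable_action i).comap_le)
    (iSup₂_le fun i _ => (b.measurable_reward i).comap_le)

theorem history_mono : Monotone b.history := fun _ _ h =>
  sup_le_sup (biSup_mono fun _ hi => hi.trans h) (biSup_mono fun _ hi => lt_of_lt_of_le hi h)

theorem measurable_action_history {i t : ℕ} (h : i ≤ t) : Measurable[b.history t] (b.action i) :=
  (comap_measurable (b.action i)).mono
    ((le_iSup₂_of_le (f := fun (i : ℕ) (_ : i ≤ t) => MeasurableSpace.comap (b.action i) inferInstance)
      i h le_rfl).trans le_sup_left) le_rfl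

theorem measurable_reward_history {i t : ℕ} (h : i < t) : Measurable[b.history t] (b.reward i) :=
  (comap_measurable (b.reward i)).mono
    ((le_iSup₂_of_le (f := fun (i : ℕ) (_ : i < t) => MeasurableSpace.comap (b.reward i) inferInstance)
      i h le_rfl).trans le_sup_right) le_rfl

theorem measurable_noise_history {i t : ℕ} (h : i < t) : Measurable[b.history t] (b.noise i) := by
  have e : b.noise i = fun ω => b.reward i ω - b.feature (b.action i ω) ⬝ᵥ b.param := by
    ext ω
    simp [reward]
  rw [e]
  exact (b.measurable_reward_history h).sub
    (b.measurable_feature_dotProduct.comp (b.measurable_action_history h.le))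

section Mixture

variable {b} {N : GaussianMixtures Ω}

theorem IsAdaptive.measurable_mean_history (hN : b.IsAdaptive N) (t : ℕ) (i : Fin t) :
    Measurable[b.history t] fun ω => N.mean t ω i := by
  cases t with
  | zero => exact i.elim0
  | succ t => exact (hN.measurable_mean t i).mono (b.history_mono t.le_succ) le_rfl

theorem IsAdaptive.measurable_cov_history (hN : b.IsAdaptive N) (t : ℕ) (i j : Fin t) :
    Measurable[b.history t] fun ω => N.cov t ω i j := by
  cases t with
  | zero => exact i.elim0
  | succ t => exact (hN.measurable_cov t i j).mono (b.history_mono t.le_succ) le_rfl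

theorem IsAdaptive.measurable_mmRadSq_history (hN : b.IsAdaptive N) (σ δ : ℝ) (t : ℕ) :
    Measurable[b.history t] (b.mmRadSq N σ δ t) :=
  @measurable_mmRadiusSq Ω (b.history t) t _ _ _ σ δ (hN.measurable_mean_history t)
    (hN.measurable_cov_history t) fun i => b.measurable_reward_history i.isLt

/-! ### The mixture supermartingale -/

variable (b N) in
/-- The logarithm of the mixture supermartingale. -/
noncomputable def logMixture (σ : ℝ) (t : ℕ) (ω : Ω) : ℝ :=
  (∑ i ∈ Finset.range t, b.noise i ω ^ 2 - b.mmRadSq N σ 1 t ω) / (2 * σ ^ 2)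

theorem IsAdaptive.measurable_logMixture (hN : b.IsAdaptive N) (σ : ℝ) (t : ℕ) :
    Measurable[b.history t] (b.logMixture N σ t) :=
  ((@Finset.measurable_sum ℝ ℕ Ω _ _ _ (b.history t) _ _ fun _ hi =>
    (b.measurable_noise_history (Finset.mem_range.mp hi)).pow_const 2).sub
      (hN.measurable_mmRadSq_history σ 1 t)).div_const _

/-- Read the mixture as a Gaussian prior on the mean rewards, observed with noise variance `σ²`.
Given the past rewards, the next mean reward has posterior variance `σ² (s - 1)`, and `g` is its
posterior mean minus the true one. Both are known before the reward of round `t`, since `history t`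
already contains its action. -/
theorem IsAdaptive.exists_logMixture_succ (hN : b.IsAdaptive N) (σ : ℝ) (t : ℕ) :
    ∃ g s : Ω → ℝ, Measurable[b.history t] g ∧ Measurable[b.history t] s ∧ (∀ ω, 1 ≤ s ω) ∧
      ∀ ω, b.logMixture N σ (t + 1) ω = b.logMixture N σ t ω +
        (b.noise t ω ^ 2 - (g ω - b.noise t ω) ^ 2 / s ω - σ ^ 2 * Real.log (s ω))
          / (2 * σ ^ 2) := by
  let c : Ω → Fin t → ℝ := fun ω i => (σ ^ 2)⁻¹ * N.cov (t + 1) ω i.castSucc (Fin.last t)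
  -- The regression coefficients of the new coordinate on the past rewards.
  let w : Ω → Fin t → ℝ := fun ω => (1 + (σ ^ 2)⁻¹ • N.cov t ω)⁻¹ *ᵥ c ω
  have hc : ∀ i, Measurable[b.history t] fun ω => c ω i := fun i =>
    (hN.measurable_cov t _ _).const_mul _
  have hw : ∀ i, Measurable[b.history t] fun ω => w ω i :=
    @measurable_mulVec_apply Ω (b.history t) t _ _
      (@measurable_inv_apply Ω (b.history t) t _
        (@measurable_one_add_smul Ω (b.history t) t _ _ (hN.measurable_cov_history t))) hc
  have hsub : ∀ ω, (N.cov (t + 1) ω).submatrix Fin.castSucc Fin.castSucc = N.cov t ω := fun ω => by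
    ext i j
    exact hN.cov_castSucc t ω i j
  have hmm := fun ω => mmRadiusSq_succ σ 1 (N.mean (t + 1) ω) (b.rewards (t + 1) ω)
    (N.cov (t + 1) ω) (hN.posSemidef_cov _ ω) (w ω) _ (by rw [hsub]) rfl
  refine ⟨fun ω => N.mean (t + 1) ω (Fin.last t) - b.feature (b.action t ω) ⬝ᵥ b.param -
      w ω ⬝ᵥ fun i => N.mean (t + 1) ω i.castSucc - b.reward i ω,
    fun ω => 1 + (σ ^ 2)⁻¹ * N.cov (t + 1) ω (Fin.last t) (Fin.last t) - c ω ⬝ᵥ w ω, ?_, ?_,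
    fun ω => (hmm ω).1, fun ω => ?_⟩
  · exact ((hN.measurable_mean t _).sub
      (b.measurable_feature_dotProduct.comp (b.measurable_action_history le_rfl))).sub
      (@measurable_dotProduct Ω (b.history t) t _ _ hw fun i =>
        (hN.measurable_mean t _).sub (b.measurable_reward_history i.isLt))
  · exact (((hN.measurable_cov t _ _).const_mul _).const_add _).sub
      (@measurable_dotProduct Ω (b.history t) t _ _ hc hw)
  · have h := (hmm ω).2
    have hm : (fun i : Fin t => N.mean (t + 1) ω i.castSucc) = N.mean t ω :=
      funext fun i => hN.mean_castSucc t ω i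
    have hr : (fun i : Fin t => b.rewards (t + 1) ω i.castSucc) = b.rewards t ω := rfl
    have hl : b.rewards (t + 1) ω (Fin.last t) =
      b.feature (b.action t ω) ⬝ᵥ b.param + b.noise t ω := rfl
    have hb : (fun i : Fin t => N.mean (t + 1) ω i.castSucc - b.rewards (t + 1) ω i.castSucc) =
      fun i : Fin t => N.mean (t + 1) ω i.castSucc - b.reward i ω := rfl
    rw [hsub, hb, hm, hr, hl] at h
    change b.mmRadSq N σ 1 (t + 1) ω = b.mmRadSq N σ 1 t ω + _ + _ at h
    unfold logMixture
    rw [h, Finset.sum_range_succ]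
    ring

/-- Time-uniform concentration: with probability at least `1 - δ`, all mixture confidence sets are
valid. -/
theorem IsAdaptive.measure_exists_noise_gt_le (hN : b.IsAdaptive N) {P : Measure Ω}
    [IsProbabilityMeasure P] {σ : ℝ} (hσ : 0 < σ) (hnoise : b.NoiseSubGaussian P σ)
    {δ : ℝ} (hδ : 0 < δ) :
    P {ω | ∃ t, b.mmRadSq N σ δ t ω < ∑ i ∈ Finset.range t, b.noise i ω ^ 2} ≤
      ENNReal.ofReal δ := by
  let W : ℕ → Ω → ENNReal := fun t ω => ENNReal.ofReal (Real.exp (b.logMixture N σ t ω))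
  have hW : ∀ t, Measurable[b.history t] (W t) := fun t =>
    (hN.measurable_logMixture σ t).exp.ennreal_ofReal
  have hville := measure_exists_le_of_lintegral_succ_le (P := P) b.history b.history_le
    b.history_mono W hW (fun t A hA => by
      obtain ⟨g, s, hg, hs, hs1, hrec⟩ := hN.exists_logMixture_succ σ t
      -- Taking the prefactor to be `W t` times the indicator of `A` localises the step to `A`.
      have h := lintegral_mul_exp_mixture_le (b.history_le t) (b.measurable_noise t) hσ
        (hnoise.integrable_exp t) (hnoise.condExp_exp_le t) ((hW t).indicator hA) hg hs hs1
      rw [lintegral_indicator (b.history_le t _ hA)] at h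
      refine le_trans (le_of_eq ?_) h
      rw [← lintegral_indicator (b.history_le t _ hA)]
      refine lintegral_congr fun ω => ?_
      by_cases hω : ω ∈ A
      · rw [Set.indicator_of_mem hω, Set.indicator_of_mem hω,
          ← ENNReal.ofReal_mul (Real.exp_pos _).le, ← Real.exp_add, ← hrec]
      · rw [Set.indicator_of_notMem hω, Set.indicator_of_notMem hω, zero_mul])
    (ENNReal.ofReal (1 / δ))
  have h0 : ∫⁻ ω, W 0 ω ∂P = 1 := by
    simp [W, logMixture, mmRadSq, mmRadiusSq]
  rw [h0, one_div, ENNReal.ofReal_inv_of_pos hδ, mul_comm, ← div_eq_mul_inv,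
    ENNReal.div_le_iff (by simpa using hδ) ENNReal.ofReal_ne_top, one_mul] at hville
  refine (measure_mono ?_).trans hville
  rintro ω ⟨t, ht⟩
  refine ⟨t, ?_⟩
  rw [← ENNReal.ofReal_inv_of_pos hδ]
  refine ENNReal.ofReal_le_ofReal ?_
  rw [← Real.log_le_iff_le_exp (by positivity), logMixture, le_div_iff₀ (by positivity)]
  -- The additive `δ`-term of the radius is exactly the logarithm of Ville's threshold, scaled by
  -- `2σ²`.
  have e : b.mmRadSq N σ δ t ω = b.mmRadSq N σ 1 t ω + 2 * σ ^ 2 * Real.log (1 / δ) := by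
    simp [mmRadSq, mmRadiusSq]
  rw [e, one_div] at ht
  linarith

end Mixture

/-! ### Regret on the event that the confidence sets are valid -/

section Regret

variable {b} {N : GaussianMixtures Ω} {σ δ B α : ℝ}

/-- The residual at `θ*` is minus the noise. Nonnegativity is recorded because `√` truncates
negative values to `0`. -/
theorem mmRadSq_nonneg_and_param_mem_conf (hparam : ‖WithLp.toLp 2 b.param‖ ≤ B) {t : ℕ} {ω : Ω}
    (h : ∑ i ∈ Finset.range t, b.noise i ω ^ 2 ≤ b.mmRadSq N σ δ t ω) :
    0 ≤ b.mmRadSq N σ δ t ω ∧ b.param ∈ b.conf N σ δ B t ω := by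
  refine ⟨(Finset.sum_nonneg fun i _ => sq_nonneg _).trans h, ?_, hparam⟩
  refine Real.le_sqrt_of_sq_le (le_trans (le_of_eq ?_) h)
  rw [norm_toLp_sq, dotProduct, Finset.sum_range]
  refine Finset.sum_congr rfl fun i _ => ?_
  have : (b.design t ω *ᵥ b.param - b.rewards t ω) i = - b.noise i ω := by
    change b.feature (b.action i ω) ⬝ᵥ b.param -
      (b.feature (b.action i ω) ⬝ᵥ b.param + b.noise i ω) = _
    ring
  rw [this]
  ring

/-- An action whose analytic upper confidence bound dominates the optimal expected reward has small
instantaneous regret. -/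
theorem regret_le_of_le_aucb (hα : 0 < α) {t : ℕ} {ω : Ω} (hR : 0 ≤ b.mmRadSq N σ δ t ω)
    (hθ : b.param ∈ b.conf N σ δ B t ω) {v : ℝ} {a : 𝒜} (hv : v ≤ b.aucb N σ δ B α t ω a) :
    v - b.feature a ⬝ᵥ b.param ≤
      2 * √(b.ammRadSq N σ δ B α t ω) * gramNorm α (b.design t ω) (b.feature a) := by
  have h := (abs_le.mp (abs_dotProduct_sub_ridge_le (b.design t ω) hα (b.rewards t ω) hR hθ
    (b.feature a))).1
  rw [aucb, ammRadSq] at hv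
  rw [ammRadSq]
  linarith

/-- The regret bound for any rule whose analytic upper confidence bounds dominate the optimal
expected rewards while the confidence sets are valid. -/
theorem holdsWithProb_regret_le {P : Measure Ω} [IsProbabilityMeasure P] (aStar : ℕ → Ω → 𝒜)
    (hσ : 0 < σ) (hnoise : b.NoiseSubGaussian P σ) (hparam : ‖WithLp.toLp 2 b.param‖ ≤ B)
    (hN : b.IsAdaptive N) (hδ : 0 < δ) (hα : 0 < α)
    (hucb : ∀ᵐ ω ∂P, ∀ t : ℕ, 0 ≤ b.mmRadSq N σ δ t ω → b.param ∈ b.conf N σ δ B t ω →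
      b.feature (aStar t ω) ⬝ᵥ b.param ≤ b.aucb N σ δ B α t ω (b.action t ω)) :
    HoldsWithProb P (1 - δ) fun ω =>
      (∀ t : ℕ, 0 ≤ b.ammRadSq N σ δ B α t ω) ∧
      ∀ T : ℕ, 1 ≤ T → b.cumRegret aStar T ω ≤ b.regretBound N σ δ B α T ω := by
  set D : Set Ω := {ω | ∃ t, b.mmRadSq N σ δ t ω < ∑ i ∈ Finset.range t, b.noise i ω ^ 2} with hD
  set Z : Set Ω := {ω | ∀ t : ℕ, 0 ≤ b.mmRadSq N σ δ t ω → b.param ∈ b.conf N σ δ B t ω →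
      b.feature (aStar t ω) ⬝ᵥ b.param ≤ b.aucb N σ δ B α t ω (b.action t ω)}ᶜ with hZ
  have hZ0 : P Z = 0 := hucb
  -- A measurable hull is taken because `Z` involves optimal actions with no assumed measurability.
  have hDZ : P (toMeasurable P (D ∪ Z)) ≤ ENNReal.ofReal δ := by
    rw [measure_toMeasurable]
    refine (measure_union_le _ _).trans ?_
    rw [hZ0, add_zero]
    exact hN.measure_exists_noise_gt_le hσ hnoise hδ
  refine ⟨(toMeasurable P (D ∪ Z))ᶜ, (measurableSet_toMeasurable _ _).compl, ?_, fun ω hω => ?_⟩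
  · rw [prob_compl_eq_one_sub (measurableSet_toMeasurable _ _), ENNReal.ofReal_sub _ hδ.le,
      ENNReal.ofReal_one]
    exact tsub_le_tsub_left hDZ 1
  · have hω' : ω ∉ D ∪ Z := fun h => hω (subset_toMeasurable _ _ h)
    have hgood : ∀ t, 0 ≤ b.mmRadSq N σ δ t ω ∧ b.param ∈ b.conf N σ δ B t ω := fun t =>
      mmRadSq_nonneg_and_param_mem_conf hparam (not_lt.mp fun h => hω' (Or.inl ⟨t, h⟩))
    have hdom := not_not.mp fun h => hω' (Or.inr h)
    exact ⟨fun t => ammRadiusSq_nonneg _ hα _ (hgood t).1 (hgood t).2, fun T _ =>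
      Finset.sum_le_sum fun t _ => regret_le_of_le_aucb hα (hgood t).1 (hgood t).2
        (hdom t (hgood t).1 (hgood t).2)⟩

end Regret

end LinearBandit

/-! ### Optimism of the two rules -/

theorem theorem3 {Ω 𝒜 : Type*} [MeasurableSpace Ω] [MeasurableSpace 𝒜] {d : ℕ}
    (P : Measure Ω) [IsProbabilityMeasure P] (b : LinearBandit Ω 𝒜 d)
    (aStar : ℕ → Ω → 𝒜) (hopt : b.IsOptimal P aStar)
    (σ : ℝ) (hσ : 0 < σ) (hnoise : b.NoiseSubGaussian P σ)
    (B : ℝ) (hB : 0 < B) (hparam : ‖WithLp.toLp 2 b.param‖ ≤ B)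
    (N : GaussianMixtures Ω) (hN : b.IsAdaptive N)
    (δ : ℝ) (hδ : 0 < δ) (hδ' : δ < 1) (α : ℝ) (hα : 0 < α) :
    (b.IsCMMUCB P N σ δ B →
      HoldsWithProb P (1 - δ) fun ω =>
        (∀ t : ℕ, 0 ≤ b.ammRadSq N σ δ B α t ω) ∧
        ∀ T : ℕ, 1 ≤ T → b.cumRegret aStar T ω ≤ b.regretBound N σ δ B α T ω) ∧
    (b.IsAMMUCB P N σ δ B α →
      HoldsWithProb P (1 - δ) fun ω =>
        (∀ t : ℕ, 0 ≤ b.ammRadSq N σ δ B α t ω) ∧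
        ∀ T : ℕ, 1 ≤ T → b.cumRegret aStar T ω ≤ b.regretBound N σ δ B α T ω) := by
  constructor
  · intro hrule
    refine LinearBandit.holdsWithProb_regret_le aStar hσ hnoise hparam hN hδ hα ?_
    filter_upwards [hopt, hrule] with ω ho hr t hR hθ
    -- The rule does not involve `α`; it enters only when the UCB is relaxed to its analytic form,
    -- so every `α` is allowed.
    calc b.feature (aStar t ω) ⬝ᵥ b.param
        ≤ ucb (b.conf N σ δ B t ω) (b.feature (aStar t ω)) := le_ucb_of_mem _ hα _ hR hθ _
      _ ≤ ucb (b.conf N σ δ B t ω) (b.feature (b.action t ω)) := (hr t).2 ⟨_, hθ⟩ (ho t).1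
      _ ≤ b.aucb N σ δ B α t ω (b.action t ω) := ucb_confSet_le _ hα _ hR ⟨_, hθ⟩ _
  · intro hrule
    refine LinearBandit.holdsWithProb_regret_le aStar hσ hnoise hparam hN hδ hα ?_
    filter_upwards [hopt, hrule] with ω ho hr t hR hθ
    -- Since `θ*` is in `Θ_t`, `R_AMM²` is nonnegative and the maximisation rule is in force.
    refine le_trans ?_ ((hr t).2 (ammRadiusSq_nonneg _ hα _ hR hθ) (ho t).1)
    have h := (abs_le.mp (abs_dotProduct_sub_ridge_le (b.design t ω) hα (b.rewards t ω) hR hθ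
      (b.feature (aStar t ω)))).2
    change _ ≤ b.feature (aStar t ω) ⬝ᵥ ridge α (b.design t ω) (b.rewards t ω) +
      √(ammRadiusSq α B (b.mmRadSq N σ δ t ω) (b.design t ω) (b.rewards t ω)) *
        gramNorm α (b.design t ω) (b.feature (aStar t ω))
    linarith
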